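/- **Setting.** All cell complexes are combinatorial 2-complexes whose 2-cells (tiles) are pentagons, the boundary of each tile being a closed path of five edges. The subdivision map $\omega$ replaces every tile by a half-dodecahedron of six pentagons: every edge is bisected at its midpoint, a smaller pentagon is placed inside every tile $t$, and each corner of the smaller pentagon is joined by an edge to the midpoint of the corresponding side of $t$; thus $t$ is divided into a central pentagon and five pentagons, one at each corner of $t$. Let $K_0$ be a single combinatorial pentagon and let $K_n:=\omega^n(K_0)$, $n\ge 0$ (the supertiles). Let $\iota_0:K_0\to K_1$ be the embedding onto the central pentagon, let $\iota_{n+1}:K_{n+1}\to K_{n+2}$ be the embedding $\omega(\iota_n)$ induced by $\iota_n$, so that $\iota_n$ maps the central pentagon of $K_n$ to the central pentagon of $K_{n+1}$, and let $K:=\varinjlim (K_n,\iota_n)$ be the combinatorial pentagonal tiling. A combinatorial tiling is a complex homeomorphic to the plane. A patch of a complex is a finite set of tiles together with all their edges and vertices. A complex $L$ is locally isomorphic to a complex $L'$ if for every patch $P$ of $L$ there is a patch $Q$ of $L'$ such that $P$ and $Q$ are isomorphic by a cell-preserving isomorphism. For a combinatorial tiling $L$ locally isomorphic to $K$, let $L_{\mathrm{aff}}$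 be the space obtained by pasting unit regular Euclidean pentagons together in the pattern of $L$. The continuous hull $\Omega$ is the set of classes $[L,x]$, where $L$ is a combinatorial tiling locally isomorphic to $K$ and $x\in L_{\mathrm{aff}}$; two pairs $(L,x)$, $(L',x')$ are in the same class if there is a cell-preserving homeomorphism $\phi:L_{\mathrm{aff}}\to L'_{\mathrm{aff}}$ which is isometric on each cell and satisfies $\phi(x)=x'$. **Theorem.** If $[L,x]\in\Omega$, then for every $n\ge 0$ the supertile $K_n$ is a subcomplex of $L$, that is, $K_n$ is isomorphic, by a cell-preserving isomorphism, to a patch of $L$. In particular, $K$ is locally isomorphic to $L$. -/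

import Mathlib

universe u v w

/-- A two-dimensional combinatorial cell complex all of whose 2-cells are pentagons.  The boundary
of the tile `t` is the closed edge path with vertices `vert t 0, …, vert t 4` and edges
`edge t 0, …, edge t 4`, where `edge t i` joins `vert t i` to `vert t (i + 1)` (indices modulo 5).
The labelling of the boundary is auxiliary: isomorphisms may rotate and reflect it.  Every vertex
and every edge lies on a tile, and no edge is a loop. -/
structure PentComplex where
  Vert : Type u
  Edge : Type u
  Tile : Type u
  ends : Edge → Sym2 Vert
  vert : Tile → Fin 5 → Vert
  edge : Tile → Fin 5 → Edge
  ends_edge : ∀ t i, ends (edge t i) = s(vert t i, vert t (i + 1))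
  loopless : ∀ e, ¬ (ends e).IsDiag
  vert_surj : ∀ v, ∃ t i, vert t i = v
  edge_surj : ∀ e, ∃ t i, edge t i = e

namespace PentComplex

/-- A cell-preserving isomorphism: bijections of the cells of each dimension which carry the
boundary of each tile to the boundary of its image, up to a rotation or a reflection. -/
structure Iso (C : PentComplex.{u}) (D : PentComplex.{v}) where
  onVert : C.Vert ≃ D.Vert
  onEdge : C.Edge ≃ D.Edge
  onTile : C.Tile ≃ D.Tile
  map_ends : ∀ e, D.ends (onEdge e) = (C.ends e).map onVert
  map_tile : ∀ t, ∃ a : Fin 5,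
    (∀ i, onVert (C.vert t i) = D.vert (onTile t) (a + i) ∧
      onEdge (C.edge t i) = D.edge (onTile t) (a + i)) ∨
    (∀ i, onVert (C.vert t i) = D.vert (onTile t) (a - i) ∧
      onEdge (C.edge t i) = D.edge (onTile t) (a - i - 1))

/-- The subcomplex formed by a set of tiles together with all their vertices and edges. -/
def sub (C : PentComplex.{u}) (S : Set C.Tile) : PentComplex.{u} where
  Vert := {x : C.Vert // ∃ t ∈ S, ∃ i, C.vert t i = x}
  Edge := {e : C.Edge // ∃ t ∈ S, ∃ i, C.edge t i = e}
  Tile := {t : C.Tile // t ∈ S}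
  ends e := (C.ends e.1).attachWith (P := fun x => ∃ t ∈ S, ∃ i, C.vert t i = x) (by
    obtain ⟨e, t, ht, i, rfl⟩ := e
    intro x hx
    rw [C.ends_edge, Sym2.mem_iff] at hx
    rcases hx with rfl | rfl
    · exact ⟨t, ht, _, rfl⟩
    · exact ⟨t, ht, _, rfl⟩)
  vert t i := ⟨C.vert t.1 i, t.1, t.2, i, rfl⟩
  edge t i := ⟨C.edge t.1 i, t.1, t.2, i, rfl⟩
  ends_edge t i := by
    apply Sym2.map.injective Subtype.val_injective
    simp only [Sym2.attachWith_map_subtypeVal, Sym2.map_mk, C.ends_edge]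
  loopless e := by
    intro h
    apply C.loopless e.1
    have h' := (Sym2.isDiag_map Subtype.val_injective).2 h
    rwa [Sym2.attachWith_map_subtypeVal] at h'
  vert_surj := by
    rintro ⟨x, t, ht, i, rfl⟩
    exact ⟨⟨t, ht⟩, i, rfl⟩
  edge_surj := by
    rintro ⟨x, t, ht, i, rfl⟩
    exact ⟨⟨t, ht⟩, i, rfl⟩

/-- `L` is locally isomorphic to `K`: every patch (finite subcomplex spanned by tiles) of `L` is
isomorphic to a patch of `K`. -/
def LocallyIsomorphic (L : PentComplex.{u}) (K : PentComplex.{v}) : Prop :=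
  ∀ S : Set L.Tile, S.Finite → ∃ Q : Set K.Tile, Q.Finite ∧ Nonempty (Iso (L.sub S) (K.sub Q))

/-- A finite complex `P` is (a copy of) a subcomplex of `L`. -/
def IsFiniteSubcomplexOf (P : PentComplex.{u}) (L : PentComplex.{v}) : Prop :=
  ∃ S : Set L.Tile, S.Finite ∧ Nonempty (Iso P (L.sub S))

/-! ### The subdivision rule -/

/-- The vertices after subdivision: the old vertices, the midpoints of the old edges, and, inside
each tile `t`, the vertices of a smaller pentagon, `inner t i` facing the edge `edge t i`. -/
inductive SubVert (C : PentComplex.{u}) : Type u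
  | old (x : C.Vert)
  | mid (e : C.Edge)
  | inner (t : C.Tile) (i : Fin 5)

/-- The edges after subdivision: the two halves of each old edge, the spokes from the midpoint of
`edge t i` to `inner t i`, and the sides of the inner pentagons. -/
inductive SubEdge (C : PentComplex.{u}) : Type u
  | half (x : C.Vert) (e : C.Edge) (h : x ∈ C.ends e)
  | spoke (t : C.Tile) (i : Fin 5)
  | inner (t : C.Tile) (i : Fin 5)

/-- The tiles after subdivision: each tile is replaced by a central pentagon and five pentagons
around it, one at each of its corners. -/
inductive SubTile (C : PentComplex.{u}) : Type u
  | center (t : C.Tile)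
  | corner (t : C.Tile) (i : Fin 5)

theorem mem_ends_left (C : PentComplex.{u}) (t : C.Tile) (i : Fin 5) :
    C.vert t i ∈ C.ends (C.edge t i) := by
  rw [C.ends_edge]; exact Sym2.mem_mk_left _ _

theorem mem_ends_right (C : PentComplex.{u}) (t : C.Tile) (i : Fin 5) :
    C.vert t i ∈ C.ends (C.edge t (i - 1)) := by
  rw [C.ends_edge]
  have : i - 1 + 1 = i := by revert i; decide
  rw [this]; exact Sym2.mem_mk_right _ _

/-- The subdivision map `ω`, replacing every pentagon by a half-dodecahedron of six pentagons. -/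
def omega (C : PentComplex.{u}) : PentComplex.{u} where
  Vert := SubVert C
  Edge := SubEdge C
  Tile := SubTile C
  ends
    | .half x e _ => s(.old x, .mid e)
    | .spoke t i => s(.mid (C.edge t i), .inner t i)
    | .inner t i => s(.inner t i, .inner t (i + 1))
  vert
    | .center t => fun i => .inner t i
    | .corner t k =>
      ![.old (C.vert t k), .mid (C.edge t k), .inner t k, .inner t (k - 1), .mid (C.edge t (k - 1))]
  edge
    | .center t => fun i => .inner t i
    | .corner t k =>
      ![.half (C.vert t k) (C.edge t k) (C.mem_ends_left t k), .spoke t k, .inner t (k - 1),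
        .spoke t (k - 1), .half (C.vert t k) (C.edge t (k - 1)) (C.mem_ends_right t k)]
  ends_edge t i := by
    cases t with
    | center t => rfl
    | corner t k =>
      have h : k - 1 + 1 = k := by revert k; decide
      fin_cases i
      · rfl
      · rfl
      · simp [h, Sym2.eq_swap]
      · simp [Sym2.eq_swap]
      · simp [Sym2.eq_swap]
  loopless e := by
    cases e with
    | half x e h => simp
    | spoke t i => simp
    | inner t i =>
      have : i ≠ i + 1 := by revert i; decide
      simp [this]
  vert_surj x := by
    cases x with
    | old x =>
      obtain ⟨t, i, rfl⟩ := C.vert_surj x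
      exact ⟨.corner t i, 0, rfl⟩
    | mid e =>
      obtain ⟨t, i, rfl⟩ := C.edge_surj e
      exact ⟨.corner t i, 1, rfl⟩
    | inner t i => exact ⟨.center t, i, rfl⟩
  edge_surj e := by
    cases e with
    | half x e h =>
      obtain ⟨t, i, rfl⟩ := C.edge_surj e
      have hx := h
      rw [C.ends_edge, Sym2.mem_iff] at hx
      rcases hx with rfl | rfl
      · exact ⟨.corner t i, 0, rfl⟩
      · refine ⟨.corner t (i + 1), 4, ?_⟩
        have : i + 1 - 1 = i := by clear h; revert i; decide
        simp [this]
    | spoke t i => exact ⟨.corner t i, 1, rfl⟩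
    | inner t i => exact ⟨.center t, i, rfl⟩

/-- An embedding of complexes preserving the labelling of the boundaries of the tiles. -/
structure Emb (C : PentComplex.{u}) (D : PentComplex.{v}) where
  onVert : C.Vert → D.Vert
  onEdge : C.Edge → D.Edge
  onTile : C.Tile → D.Tile
  map_ends : ∀ e, D.ends (onEdge e) = (C.ends e).map onVert
  map_vert : ∀ t i, onVert (C.vert t i) = D.vert (onTile t) i
  map_edge : ∀ t i, onEdge (C.edge t i) = D.edge (onTile t) i
  inj_vert : Function.Injective onVert
  inj_edge : Function.Injective onEdge
  inj_tile : Function.Injective onTile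

/-- The embedding `ω(C) → ω(D)` induced by an embedding `C → D`. -/
def Emb.omega {C : PentComplex.{u}} {D : PentComplex.{v}} (f : Emb C D) :
    Emb C.omega D.omega where
  onVert
    | .old x => .old (f.onVert x)
    | .mid e => .mid (f.onEdge e)
    | .inner t i => .inner (f.onTile t) i
  onEdge
    | .half x e h => .half (f.onVert x) (f.onEdge e)
        (by rw [f.map_ends]; exact Sym2.mem_map.2 ⟨x, h, rfl⟩)
    | .spoke t i => .spoke (f.onTile t) i
    | .inner t i => .inner (f.onTile t) i
  onTile
    | .center t => .center (f.onTile t)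
    | .corner t k => .corner (f.onTile t) k
  map_ends e := by
    cases e <;> simp [PentComplex.omega, f.map_edge]
  map_vert t i := by
    cases t with
    | center t => rfl
    | corner t k => fin_cases i <;> simp [PentComplex.omega, f.map_edge, f.map_vert]
  map_edge t i := by
    cases t with
    | center t => rfl
    | corner t k => fin_cases i <;> simp [PentComplex.omega, f.map_edge, f.map_vert]
  inj_vert
    | .old _, .old _, h => congrArg _ (f.inj_vert (SubVert.old.inj h))
    | .mid _, .mid _, h => congrArg _ (f.inj_edge (SubVert.mid.inj h))
    | .inner _ _, .inner _ _, h =>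
      congrArg₂ _ (f.inj_tile (SubVert.inner.inj h).1) (SubVert.inner.inj h).2
  inj_edge
    | .half _ _ _, .half _ _ _, h => by
      obtain ⟨h1, h2⟩ := SubEdge.half.inj h
      obtain rfl := f.inj_vert h1
      obtain rfl := f.inj_edge h2
      rfl
    | .spoke _ _, .spoke _ _, h =>
      congrArg₂ _ (f.inj_tile (SubEdge.spoke.inj h).1) (SubEdge.spoke.inj h).2
    | .inner _ _, .inner _ _, h =>
      congrArg₂ _ (f.inj_tile (SubEdge.inner.inj h).1) (SubEdge.inner.inj h).2
  inj_tile
    | .center _, .center _, h => congrArg _ (f.inj_tile (SubTile.center.inj h))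
    | .corner _ _, .corner _ _, h =>
      congrArg₂ _ (f.inj_tile (SubTile.corner.inj h).1) (SubTile.corner.inj h).2

/-! ### The direct limit of a sequence of embeddings -/

/-- One step in the disjoint union of a sequence of sets. -/
def shift {A : ℕ → Type u} (f : ∀ n, A n → A (n + 1)) (x : Σ n, A n) : Σ n, A n :=
  ⟨x.1 + 1, f x.1 x.2⟩

/-- Two elements of the disjoint union represent the same element of the direct limit if they
become equal after finitely many steps. -/
def limSetoid {A : ℕ → Type u} (f : ∀ n, A n → A (n + 1)) : Setoid (Σ n, A n) where
  r x y := ∃ k l, (shift f)^[k] x = (shift f)^[l] y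
  iseqv := by
    refine ⟨fun x => ⟨0, 0, rfl⟩, fun ⟨k, l, h⟩ => ⟨l, k, h.symm⟩, ?_⟩
    rintro x y z ⟨k, l, h⟩ ⟨k', l', h'⟩
    refine ⟨k' + k, l + l', ?_⟩
    rw [Function.iterate_add_apply, h, ← Function.iterate_add_apply, add_comm k' l,
      Function.iterate_add_apply, h', ← Function.iterate_add_apply]

/-- The direct limit of a sequence of sets. -/
abbrev Lim {A : ℕ → Type u} (f : ∀ n, A n → A (n + 1)) : Type u := Quotient (limSetoid f)

/-- The canonical map from the `n`-th set to the direct limit. -/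
def Lim.of {A : ℕ → Type u} (f : ∀ n, A n → A (n + 1)) (n : ℕ) (x : A n) : Lim f :=
  Quotient.mk (limSetoid f) ⟨n, x⟩

theorem Lim.of_succ {A : ℕ → Type u} (f : ∀ n, A n → A (n + 1)) (n : ℕ) (x : A n) :
    Lim.of f (n + 1) (f n x) = Lim.of f n x :=
  Quotient.sound ⟨0, 1, rfl⟩

theorem Lim.of_injective {A : ℕ → Type u} (f : ∀ n, A n → A (n + 1))
    (hf : ∀ n, Function.Injective (f n)) (n : ℕ) : Function.Injective (Lim.of f n) := by
  have hs : Function.Injective (shift f) := by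
    rintro ⟨m, x⟩ ⟨m', y⟩ h
    simp only [shift, Sigma.mk.injEq, Nat.add_right_cancel_iff] at h
    obtain ⟨rfl, h⟩ := h
    rw [hf m (eq_of_heq h)]
  have hfst : ∀ (k : ℕ) (x : Σ n, A n), ((shift f)^[k] x).1 = x.1 + k := by
    intro k
    induction k with
    | zero => intro x; rfl
    | succ k ih =>
      intro x
      rw [Function.iterate_succ_apply, ih]
      simp only [shift]; omega
  intro x y h
  obtain ⟨k, l, h⟩ := Quotient.exact h
  have hkl : k = l := by
    have := congrArg Sigma.fst h
    rw [hfst, hfst] at this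
    simpa using this
  subst hkl
  exact eq_of_heq (Sigma.mk.inj (hs.iterate k h)).2

/-- A map out of a direct limit, from a compatible family of maps. -/
def Lim.desc {A : ℕ → Type u} (f : ∀ n, A n → A (n + 1)) {B : Type w} (g : ∀ n, A n → B)
    (hg : ∀ n x, g (n + 1) (f n x) = g n x) : Lim f → B :=
  Quotient.lift (fun x : Σ n, A n => g x.1 x.2) (by
    have key : ∀ (k : ℕ) (x : Σ n, A n),
        g ((shift f)^[k] x).1 ((shift f)^[k] x).2 = g x.1 x.2 := by
      intro k
      induction k with
      | zero => intro x; rfl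
      | succ k ih =>
        intro x
        rw [Function.iterate_succ_apply, ih]
        exact hg _ _
    rintro x y ⟨k, l, h⟩
    rw [← key k x, h, key l y])

/-- The direct limit of a sequence of complexes and embeddings. -/
def directLimit (C : ℕ → PentComplex.{u}) (f : ∀ n, Emb (C n) (C (n + 1))) : PentComplex.{u} where
  Vert := Lim (fun n => (f n).onVert)
  Edge := Lim (fun n => (f n).onEdge)
  Tile := Lim (fun n => (f n).onTile)
  ends := Lim.desc _ (fun n e => ((C n).ends e).map (Lim.of (fun n => (f n).onVert) n)) (by
    intro n e
    rw [(f n).map_ends, Sym2.map_map]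
    congr 1
    funext x
    exact Lim.of_succ (fun n => (f n).onVert) n x)
  vert := Lim.desc _ (fun n t i => Lim.of (fun n => (f n).onVert) n ((C n).vert t i)) (by
    intro n t
    funext i
    rw [← (f n).map_vert]
    exact Lim.of_succ (fun n => (f n).onVert) n _)
  edge := Lim.desc _ (fun n t i => Lim.of (fun n => (f n).onEdge) n ((C n).edge t i)) (by
    intro n t
    funext i
    rw [← (f n).map_edge]
    exact Lim.of_succ (fun n => (f n).onEdge) n _)
  ends_edge t i := by
    obtain ⟨⟨n, t⟩, rfl⟩ := Quotient.exists_rep t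
    change Sym2.map _ ((C n).ends ((C n).edge t i)) = _
    rw [(C n).ends_edge]
    rfl
  loopless e := by
    obtain ⟨⟨n, e⟩, rfl⟩ := Quotient.exists_rep e
    change ¬ (Sym2.map (Lim.of (fun n => (f n).onVert) n) ((C n).ends e)).IsDiag
    rw [Sym2.isDiag_map (Lim.of_injective _ (fun n => (f n).inj_vert) n)]
    exact (C n).loopless e
  vert_surj x := by
    obtain ⟨⟨n, x⟩, rfl⟩ := Quotient.exists_rep x
    obtain ⟨t, i, rfl⟩ := (C n).vert_surj x
    exact ⟨Lim.of _ n t, i, rfl⟩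
  edge_surj x := by
    obtain ⟨⟨n, x⟩, rfl⟩ := Quotient.exists_rep x
    obtain ⟨t, i, rfl⟩ := (C n).edge_surj x
    exact ⟨Lim.of _ n t, i, rfl⟩

/-! ### The supertiles and the combinatorial pentagonal tiling -/

/-- The combinatorial pentagon. -/
def pentagon : PentComplex.{0} where
  Vert := Fin 5
  Edge := Fin 5
  Tile := Unit
  ends i := s(i, i + 1)
  vert _ i := i
  edge _ i := i
  ends_edge _ _ := rfl
  loopless := by
    intro i
    have : i ≠ i + 1 := by revert i; decide
    simp [this]
  vert_surj i := ⟨(), i, rfl⟩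
  edge_surj i := ⟨(), i, rfl⟩

/-- The supertile `K_n = ω^n(K_0)`. -/
def supertile : ℕ → PentComplex.{0}
  | 0 => pentagon
  | n + 1 => (supertile n).omega

/-- The embedding of `K_0` onto the central pentagon of `K_1`. -/
def centralEmb : Emb pentagon pentagon.omega where
  onVert i := .inner () i
  onEdge i := .inner () i
  onTile t := .center t
  map_ends _ := rfl
  map_vert _ _ := rfl
  map_edge _ _ := rfl
  inj_vert _ _ h := (SubVert.inner.inj h).2
  inj_edge _ _ h := (SubEdge.inner.inj h).2
  inj_tile _ _ _ := rfl

/-- The embedding `ι_n : K_n → K_{n+1}` taking the central pentagon to the central pentagon. -/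
def iota : ∀ n, Emb (supertile n) (supertile (n + 1))
  | 0 => centralEmb
  | n + 1 => (iota n).omega

/-- The combinatorial pentagonal tiling `K`, the direct limit of the supertiles. -/
def tilingK : PentComplex.{0} := directLimit supertile iota

/-! ### The piecewise affine realization -/

/-- The corners of the regular Euclidean pentagon of side length one centred at the origin. -/
noncomputable def cornerC (k : Fin 5) : ℂ :=
  Complex.exp (2 * Real.pi * Complex.I * ((k : ℕ) : ℂ) / 5) / (2 * Real.sin (Real.pi / 5) : ℝ)

/-- The closed regular Euclidean pentagon of side length one. -/
abbrev Pentagon : Type := {z : ℂ // z ∈ convexHull ℝ (Set.range cornerC)}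

/-- The point at parameter `s` on the side of the pentagon from corner `i` to corner `i + 1`. -/
noncomputable def sidePoint (i : Fin 5) (s : unitInterval) : Pentagon :=
  ⟨(1 - (s : ℝ)) • cornerC i + (s : ℝ) • cornerC (i + 1),
    convex_convexHull ℝ _ (subset_convexHull ℝ _ (Set.mem_range_self i))
      (subset_convexHull ℝ _ (Set.mem_range_self (i + 1)))
      (sub_nonneg.2 s.2.2) s.2.1 (by ring)⟩

/-- The `i`-th corner as a point of the pentagon. -/
noncomputable def cornerPoint (i : Fin 5) : Pentagon :=
  ⟨cornerC i, subset_convexHull ℝ _ (Set.mem_range_self i)⟩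

/-- The gluing of the disjoint union of unit regular pentagons, one for each tile: corners at the
same vertex are identified, and sides on the same edge are identified by the isometry that respects
their end points. -/
inductive Glue (C : PentComplex.{u}) :
    (Σ _ : C.Tile, Pentagon) → (Σ _ : C.Tile, Pentagon) → Prop
  | vert (t t' : C.Tile) (i j : Fin 5) (h : C.vert t i = C.vert t' j) :
      Glue C ⟨t, cornerPoint i⟩ ⟨t', cornerPoint j⟩
  | edge (t t' : C.Tile) (i j : Fin 5) (s : unitInterval) (h : C.edge t i = C.edge t' j)
      (h0 : C.vert t i = C.vert t' j) : Glue C ⟨t, sidePoint i s⟩ ⟨t', sidePoint j s⟩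
  | edgeRev (t t' : C.Tile) (i j : Fin 5) (s : unitInterval) (h : C.edge t i = C.edge t' j)
      (h0 : C.vert t i = C.vert t' (j + 1)) :
      Glue C ⟨t, sidePoint i s⟩ ⟨t', sidePoint j (unitInterval.symm s)⟩

/-- The space `L_aff` obtained by pasting unit regular pentagons in the pattern of `L`, with the
topology of a cell complex (the quotient topology). -/
def Aff (L : PentComplex.{u}) : Type u := Quot (Glue L)

instance (L : PentComplex.{u}) : TopologicalSpace L.Aff :=
  inferInstanceAs (TopologicalSpace (Quot (Glue L)))

/-- The characteristic map of a tile; it transports the Euclidean metric to the closed tile. -/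
def chart (L : PentComplex.{u}) (t : L.Tile) (p : Pentagon) : L.Aff := Quot.mk _ ⟨t, p⟩

/-- A combinatorial tiling is a cell complex homeomorphic to the plane. -/
def IsCombinatorialTiling (L : PentComplex.{u}) : Prop := Nonempty (L.Aff ≃ₜ ℂ)

end PentComplex

/-! ### The continuous hull -/

/-- A pair `(L, x)` of a combinatorial tiling `L` locally isomorphic to `K` and a point `x` of
`L_aff`. -/
structure PointedTiling where
  L : PentComplex.{u}
  tiling : L.IsCombinatorialTiling
  locIso : L.LocallyIsomorphic PentComplex.tilingK
  x : L.Aff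

/-- `(L, x)` and `(L', x')` are isomorphic if some homeomorphism from `L_aff` to `L'_aff` takes `x`
to `x'` and takes the closed tiles of `L` isometrically onto the closed tiles of `L'`. -/
def PointedTiling.Isom (p : PointedTiling.{u}) (q : PointedTiling.{u}) : Prop :=
  ∃ φ : p.L.Aff ≃ₜ q.L.Aff, φ p.x = q.x ∧
    (∀ t, ∃ t', ∃ g : PentComplex.Pentagon ≃ᵢ PentComplex.Pentagon,
      ∀ z, φ (p.L.chart t z) = q.L.chart t' (g z)) ∧
    (∀ t', ∃ t, ∃ g : PentComplex.Pentagon ≃ᵢ PentComplex.Pentagon,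
      ∀ z, φ (p.L.chart t z) = q.L.chart t' (g z))

instance PointedTiling.setoid : Setoid PointedTiling.{u} where
  r := PointedTiling.Isom
  iseqv := by
    refine ⟨?_, ?_, ?_⟩
    · intro p
      exact ⟨Homeomorph.refl _, rfl, fun t => ⟨t, IsometryEquiv.refl _, fun _ => rfl⟩,
        fun t => ⟨t, IsometryEquiv.refl _, fun _ => rfl⟩⟩
    · rintro p q ⟨φ, hx, h1, h2⟩
      refine ⟨φ.symm, ?_, ?_, ?_⟩
      · rw [← hx, φ.symm_apply_apply]
      · intro t'
        obtain ⟨t, g, h⟩ := h2 t'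
        refine ⟨t, g.symm, fun z => ?_⟩
        rw [Homeomorph.symm_apply_eq, h, g.apply_symm_apply]
      · intro t
        obtain ⟨t', g, h⟩ := h1 t
        refine ⟨t', g.symm, fun z => ?_⟩
        rw [Homeomorph.symm_apply_eq, h, g.apply_symm_apply]
    · rintro p q r ⟨φ, hx, h1, h2⟩ ⟨ψ, hy, k1, k2⟩
      refine ⟨φ.trans ψ, ?_, ?_, ?_⟩
      · rw [Homeomorph.trans_apply, hx, hy]
      · intro t
        obtain ⟨t', g, h⟩ := h1 t
        obtain ⟨t'', g', h'⟩ := k1 t'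
        exact ⟨t'', g.trans g', fun z => by
          rw [Homeomorph.trans_apply, h, h', IsometryEquiv.trans_apply]⟩
      · intro t''
        obtain ⟨t', g', h'⟩ := k2 t''
        obtain ⟨t, g, h⟩ := h2 t'
        exact ⟨t, g.trans g', fun z => by
          rw [Homeomorph.trans_apply, h, h', IsometryEquiv.trans_apply]⟩

/-- The continuous hull `Ω` of `K`. -/
def ContinuousHull : Type (u + 1) := Quotient PointedTiling.setoid.{u}

/-- The class `[L, x]`. -/
def ContinuousHull.mk (p : PointedTiling.{u}) : ContinuousHull.{u} := Quotient.mk _ p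

/-! Local isomorphism only says that patches of `L` occur in `K`; the point is to reverse this. Take
a tile of `L`, a ball of large radius `R` around it (distance counted in edge crossings), and a copy
of this ball in `K`. The copy must fill the whole `R`-ball of `K` around the image of the centre.
Indeed an edge of `L` lies on two tiles, since the plane has no boundary, while an edge of `K` lies
on at most two; so crossing an edge in `K` never leads to a tile that the copy misses
(`ball_subset_of_iso`).

Every tile of `K` lies in some copy of `K_n`, because `K_{m+n}` is the `n`-fold subdivision of `K_m`
(`exists_emb_supertile_tilingK`). As `K_n` is finite and connected, some `R` makes the ball swallow
this copy, which can then be pulled back to `L` (`nonempty_cellEmb_supertile`). Every patch of `K`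
lies in some `K_n`, so it occurs in `L` too.

The topological input is `exists_other_side`. Near the midpoint of an unglued side the space would
look like a half-disc, from which the boundary point can be removed without creating a hole; a small
circle in the plane would then contract in the punctured plane. The combinatorial input is `IsTame`,
which survives subdivision and passes from `K` to `L` because it can be tested on finite patches. -/

/-! ### Winding around the origin, by lifting through the exponential -/

theorem Complex.eq_of_continuous_of_exp_eq {X : Type*} [TopologicalSpace X] [PreconnectedSpace X]
    {F : X → ℂ} (hF : Continuous F) {c : ℂ} (h : ∀ x, Complex.exp (F x) = c) (x y : X) :
    F x = F y :=
  Complex.isCoveringMap_exp.const_of_comp hF (fun a b => Subtype.ext (by simp [h])) x y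

/-- The circle of radius `r` around the origin is not freely null-homotopic in the punctured
plane. -/
theorem Complex.not_nullhomotopic_circle (H : C(unitInterval × ℝ, ℂ)) (hne : ∀ x, H x ≠ 0)
    {c : ℂ} (h0 : ∀ τ, H (0, τ) = c) (hper : ∀ s, H (s, 2 * Real.pi) = H (s, 0))
    {r : ℂ} (h1 : ∀ τ : ℝ, H (1, τ) = r * Complex.exp (τ * Complex.I)) : False := by
  have hc : c ≠ 0 := h0 0 ▸ hne _
  let H' : C(unitInterval × ℝ, {z : ℂ // z ≠ 0}) :=
    ⟨fun x => ⟨H x, hne x⟩, H.continuous.subtype_mk _⟩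
  have hstart : ∀ τ, H' (0, τ) =
      (fun z : ℂ => (⟨_, z.exp_ne_zero⟩ : {z : ℂ // z ≠ 0})) (ContinuousMap.const ℝ (log c) τ) := by
    intro τ
    apply Subtype.ext
    simp [H', h0, Complex.exp_log hc]
  let Φ := Complex.isCoveringMap_exp.liftHomotopy H' (ContinuousMap.const ℝ (log c)) hstart
  have hexp : ∀ x, Complex.exp (Φ x) = H x := fun x =>
    congrArg Subtype.val
      (congrFun (Complex.isCoveringMap_exp.liftHomotopy_lifts H' _ hstart) x)
  have hzero : ∀ τ, Φ (0, τ) = log c := fun τ =>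
    Complex.isCoveringMap_exp.liftHomotopy_zero H' _ hstart τ
  -- The increment of the lifted logarithm over one period is a logarithm of 1, hence independent of
  -- `s`. It is 0 at `s = 0`, where the loop is constant, and `2πi` at `s = 1`, where the lift is
  -- `iτ` plus a constant.
  have hD := Complex.eq_of_continuous_of_exp_eq (X := unitInterval) (c := 1)
    (F := fun s => Φ (s, 2 * Real.pi) - Φ (s, 0)) (by fun_prop)
    (fun s => by rw [Complex.exp_sub, hexp, hexp, hper, div_self (hne _)]) 0 1
  have hE := Complex.eq_of_continuous_of_exp_eq (X := ℝ) (c := r)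
    (F := fun τ => Φ (1, τ) - τ * Complex.I) (by fun_prop)
    (fun τ => by
      rw [Complex.exp_sub, hexp, h1, mul_div_cancel_right₀ _ (Complex.exp_ne_zero _)])
    (2 * Real.pi) 0
  simp only [hzero, sub_self, Complex.ofReal_zero, zero_mul, sub_zero] at hD hE
  rw [← hE] at hD
  have : (2 * Real.pi : ℂ) * Complex.I = 0 := by
    push_cast at hD
    linear_combination -hD
  exact Complex.two_pi_I_ne_zero this

/-! ### Planarity: no side of a tile is left unglued -/

namespace PentComplex

/-- Each side of the regular pentagon is the face on which some linear functional is maximal. -/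
theorem exists_side_functional : ∃ (f : Fin 5 → ℂ →L[ℝ] ℝ) (c : ℝ), ∀ j k : Fin 5,
    f j (cornerC k) ≤ c ∧ (f j (cornerC k) = c ↔ k = j ∨ k = j + 1) := by
  let q : ℝ := 2 * Real.sin (Real.pi / 5)
  have hq : 0 < q := mul_pos two_pos (Real.sin_pos_of_pos_of_lt_pi (by positivity)
    (by linarith [Real.pi_pos]))
  -- The outward normal of side `j` has argument `(2j + 1)π/5`; multiplication by `a j` turns it
  -- onto the positive real axis, so the real part becomes the height over that side.
  let a : Fin 5 → ℂ := fun j =>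
    Complex.exp ((-((2 * (j : ℕ) + 1) * (Real.pi / 5)) : ℝ) * Complex.I)
  have hval : ∀ j k : Fin 5, (a j * cornerC k).re =
      Real.cos (((2 * (k : ℕ) - 2 * (j : ℕ) - 1 : ℤ) : ℝ) * (Real.pi / 5)) / q := by
    intro j k
    have : a j * cornerC k = Complex.exp
        (((((2 * (k : ℕ) - 2 * (j : ℕ) - 1 : ℤ) : ℝ) * (Real.pi / 5) : ℝ) : ℂ) * Complex.I)
        / (q : ℝ) := by
      simp only [a, cornerC, q]
      rw [← mul_div_assoc, ← Complex.exp_add]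
      congr 2
      push_cast
      ring
    rw [this, Complex.div_ofReal_re, Complex.exp_ofReal_mul_I_re]
  have hpi := Real.pi_pos
  have h3 : Real.cos (3 * (Real.pi / 5)) < Real.cos (Real.pi / 5) :=
    Real.cos_lt_cos_of_nonneg_of_le_pi (by positivity) (by linarith) (by linarith)
  have h5 : Real.cos (5 * (Real.pi / 5)) < Real.cos (Real.pi / 5) :=
    Real.cos_lt_cos_of_nonneg_of_le_pi (by positivity) (by linarith) (by linarith)
  have h7 : Real.cos (7 * (Real.pi / 5)) = Real.cos (3 * (Real.pi / 5)) := by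
    rw [← Real.cos_two_pi_sub]; congr 1; ring
  have h9 : Real.cos (9 * (Real.pi / 5)) = Real.cos (Real.pi / 5) := by
    rw [← Real.cos_two_pi_sub]; congr 1; ring
  -- Among odd `m`, `cos (mπ/5)` is maximal exactly when `m ≡ ±1` modulo 10.
  have hcases : ∀ j k : Fin 5, let m : ℤ := 2 * (k : ℕ) - 2 * (j : ℕ) - 1
      ((k = j ∨ k = j + 1) ∧ (m = 1 ∨ m = -1 ∨ m = 9 ∨ m = -9)) ∨
      (¬ (k = j ∨ k = j + 1) ∧
        (m = 3 ∨ m = -3 ∨ m = 5 ∨ m = -5 ∨ m = 7 ∨ m = -7)) := by decide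
  have key : ∀ j k : Fin 5,
      ((k = j ∨ k = j + 1) ∧ (a j * cornerC k).re = Real.cos (Real.pi / 5) / q) ∨
      (¬ (k = j ∨ k = j + 1) ∧ (a j * cornerC k).re < Real.cos (Real.pi / 5) / q) := by
    intro j k
    rw [hval]
    rcases hcases j k with ⟨h, hm⟩ | ⟨h, hm⟩
    · left
      refine ⟨h, ?_⟩
      rcases hm with hm | hm | hm | hm <;> rw [hm] <;> simp [h9, neg_mul, Real.cos_neg]
    · right
      refine ⟨h, (div_lt_div_iff_of_pos_right hq).2 ?_⟩
      rcases hm with hm | hm | hm | hm | hm | hm <;> rw [hm] <;> push_cast <;>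
        simp only [neg_mul, Real.cos_neg, h7, h3, h5]
  refine ⟨fun j => Complex.reCLM.comp (ContinuousLinearMap.mul ℝ ℂ (a j)),
    Real.cos (Real.pi / 5) / q, fun j k => ?_⟩
  change (a j * cornerC k).re ≤ _ ∧ ((a j * cornerC k).re = _ ↔ _)
  rcases key j k with ⟨h, hk⟩ | ⟨h, hk⟩
  · exact ⟨hk.le, iff_of_true hk h⟩
  · exact ⟨hk.le, iff_of_false hk.ne h⟩

section Saturation

variable {L : PentComplex.{u}} {t : L.Tile} {W : Set Pentagon}

/-- No point of `W` is glued to a different point, so membership in a subset of `W` is invariant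
under the gluing and descends to the quotient. -/
theorem chart_mem_image_iff (hW : ∀ x y, Glue L x y →
      x ∈ Sigma.mk t '' W ∨ y ∈ Sigma.mk t '' W → x = y)
    {V : Set Pentagon} (hV : V ⊆ W) (x : Σ _ : L.Tile, Pentagon) :
    (Quot.mk _ x : L.Aff) ∈ L.chart t '' V ↔ x ∈ Sigma.mk t '' V := by
  constructor
  · rintro ⟨z, hz, hzx⟩
    let P : L.Aff → Prop := Quot.lift (fun y => y ∈ Sigma.mk t '' V) (by
      intro y y' h
      apply propext
      constructor
      · intro hy
        rwa [← hW y y' h (Or.inl (Set.image_mono hV hy))]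
      · intro hy
        rwa [hW y y' h (Or.inr (Set.image_mono hV hy))])
    have : P (L.chart t z) := ⟨z, hz, rfl⟩
    rw [hzx] at this
    exact this
  · rintro ⟨z, hz, rfl⟩
    exact ⟨z, hz, rfl⟩

theorem continuous_chart (L : PentComplex.{u}) (t : L.Tile) : Continuous (L.chart t) :=
  continuous_quot_mk.comp continuous_sigmaMk

/-- Subsets of `W` are saturated for the gluing: applied to singletons this gives injectivity,
applied to open sets it gives openness. -/
theorem isOpenEmbedding_chart (hW : ∀ x y, Glue L x y →
      x ∈ Sigma.mk t '' W ∨ y ∈ Sigma.mk t '' W → x = y) (hWo : IsOpen W) :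
    Topology.IsOpenEmbedding (fun z : W => L.chart t z) := by
  refine .of_continuous_injective_isOpenMap ((L.continuous_chart t).comp continuous_subtype_val)
    ?_ ?_
  · rintro ⟨z, hz⟩ ⟨w, hw⟩ h
    obtain ⟨z', hz', h'⟩ := (chart_mem_image_iff hW (Set.singleton_subset_iff.2 hz) ⟨t, w⟩).1
      ⟨z, rfl, h⟩
    obtain rfl : z' = z := hz'
    exact Subtype.ext (eq_of_heq (Sigma.mk.inj h').2)
  · intro V hV
    have hV' : IsOpen (Subtype.val '' V) := hWo.isOpenMap_subtype_val V hV
    have : (fun z : W => L.chart t z) '' V = L.chart t '' (Subtype.val '' V) := by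
      rw [Set.image_image]
    rw [this]
    refine isOpen_coinduced.2 ?_
    have hpre : Quot.mk (Glue L) ⁻¹' (L.chart t '' (Subtype.val '' V)) =
        Sigma.mk t '' (Subtype.val '' V) := by
      ext x
      exact chart_mem_image_iff hW (by rintro _ ⟨z, -, rfl⟩; exact z.2) x
    exact hpre ▸ isOpenMap_sigmaMk _ hV'

end Saturation

/-- In a combinatorial tiling every side of a tile is glued to another side of a tile. -/
theorem IsCombinatorialTiling.exists_other_side {L : PentComplex.{u}}
    (hL : L.IsCombinatorialTiling) (t : L.Tile) (i : Fin 5) :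
    ∃ t' j, L.edge t' j = L.edge t i ∧ ¬ (t' = t ∧ j = i) := by
  by_contra! huniq
  obtain ⟨φ⟩ := hL
  obtain ⟨f, c, hf⟩ := exists_side_functional
  have hle : ∀ j (z : Pentagon), f j z ≤ c := by
    intro j z
    have : convexHull ℝ (Set.range cornerC) ⊆ {z | f j z ≤ c} :=
      convexHull_min (by rintro _ ⟨k, rfl⟩; exact (hf j k).1)
        (convex_halfSpace_le (f j).toLinearMap.isLinear c)
    exact this z.2
  have hside : ∀ k j s, f k (sidePoint j s).1 =
      (1 - (s : ℝ)) * f k (cornerC j) + s * f k (cornerC (j + 1)) := by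
    intro k j s
    simp only [sidePoint, map_add, map_smul, smul_eq_mul]
  have hside' : ∀ j s, f j (sidePoint j s).1 = c := by
    intro j s
    rw [hside, (hf j j).2.2 (Or.inl rfl), (hf j (j + 1)).2.2 (Or.inr rfl)]
    ring
  -- The tile minus its other four closed sides. Each corner lies on two sides, so only the relative
  -- interior of side `i` remains on the boundary, and this is assumed to be glued to nothing else.
  let W : Set Pentagon := {z | ∀ j, j ≠ i → f j z < c}
  have hWo : IsOpen W := by
    simp only [W, Set.ofPred_forall]
    refine isOpen_iInter_of_finite fun j => isOpen_iInter_of_finite fun _ => ?_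
    exact isOpen_lt ((f j).continuous.comp continuous_subtype_val) continuous_const
  have hWside : ∀ j s, sidePoint j s ∈ W → j = i := by
    intro j s h
    by_contra hj
    exact (h j hj).ne (hside' j s)
  have hWcorner : ∀ j, cornerPoint j ∉ W := by
    intro j h
    have h1 : j = i := by
      by_contra hj
      exact (h j hj).ne ((hf j j).2.2 (Or.inl rfl))
    have h2 : j - 1 = i := by
      by_contra hj
      exact (h (j - 1) hj).ne ((hf (j - 1) j).2.2 (Or.inr (by simp)))
    rw [h1] at h2
    clear * - h2
    revert i
    decide
  have hmem : ∀ t' z, (⟨t', z⟩ : Σ _ : L.Tile, Pentagon) ∈ Sigma.mk t '' W → t' = t ∧ z ∈ W := by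
    rintro t' z ⟨w, hw, h⟩
    cases h
    exact ⟨rfl, hw⟩
  have hW : ∀ x y, Glue L x y → x ∈ Sigma.mk t '' W ∨ y ∈ Sigma.mk t '' W → x = y := by
    rintro x y h hxy
    -- Rules out gluing a side to itself with reversed orientation.
    have hloop : ∀ t' j, L.vert t' j ≠ L.vert t' (j + 1) := by
      intro t' j h
      apply L.loopless (L.edge t' j)
      rw [L.ends_edge, h]
      exact Sym2.diag_isDiag _
    cases h with
    | vert t₁ t₂ j k h =>
      rcases hxy with h | h <;> exact absurd (hmem _ _ h).2 (hWcorner _)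
    | edge t₁ t₂ j k s h h0 =>
      rcases hxy with h' | h'
      · obtain ⟨rfl, hw⟩ := hmem _ _ h'
        obtain rfl := hWside _ _ hw
        obtain ⟨rfl, rfl⟩ := huniq _ _ h.symm
        rfl
      · obtain ⟨rfl, hw⟩ := hmem _ _ h'
        obtain rfl := hWside _ _ hw
        obtain ⟨rfl, rfl⟩ := huniq _ _ h
        rfl
    | edgeRev t₁ t₂ j k s h h0 =>
      rcases hxy with h' | h'
      · obtain ⟨rfl, hw⟩ := hmem _ _ h'
        obtain rfl := hWside _ _ hw
        obtain ⟨rfl, rfl⟩ := huniq _ _ h.symm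
        exact absurd h0 (hloop _ _)
      · obtain ⟨rfl, hw⟩ := hmem _ _ h'
        obtain rfl := hWside _ _ hw
        obtain ⟨rfl, rfl⟩ := huniq _ _ h
        exact absurd h0 (hloop _ _)
  -- the midpoint of the side, and a point of the interior
  let p : Pentagon := sidePoint i ⟨1 / 2, by norm_num, by norm_num⟩
  have hpW : p ∈ W := by
    intro j hj
    have h1 := (hf j i).1
    have h2 := (hf j (i + 1)).1
    have h3 : f j p = (f j (cornerC i) + f j (cornerC (i + 1))) / 2 := by
      rw [hside]; norm_num; ring
    rw [h3]
    by_contra! hlt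
    have e1 := (hf j i).2.1 (by linarith)
    have e2 := (hf j (i + 1)).2.1 (by linarith)
    clear * - hj e1 e2
    revert i j
    decide
  let comb (s : unitInterval) (z w : Pentagon) : Pentagon :=
    ⟨(1 - (s : ℝ)) • (z : ℂ) + (s : ℝ) • (w : ℂ),
      convex_convexHull ℝ _ z.2 w.2 (sub_nonneg.2 s.2.2) s.2.1 (by ring)⟩
  have hcomb : ∀ s z w j, f j (comb s z w) = (1 - (s : ℝ)) * f j z + s * f j w := by
    intro s z w j
    simp only [comb, map_add, map_smul, smul_eq_mul]
  -- Corner `i + 3` is opposite side `i`, so the midpoint between it and `p` is off all five sides.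
  let z₀ : Pentagon := comb ⟨1 / 2, by norm_num, by norm_num⟩ p (cornerPoint (i + 3))
  have hz₀ : ∀ j, f j z₀ < c := by
    intro j
    have h0 : f j z₀ = (f j p + f j (cornerC (i + 3))) / 2 := by
      rw [hcomb]; norm_num [cornerPoint]; ring
    have h1 := (hf j (i + 3)).1
    rw [h0]
    by_cases hj : j = i
    · have h2 : f j (cornerC (i + 3)) ≠ c := by
        rw [Ne, (hf j (i + 3)).2, hj]
        clear * -
        revert i
        decide
      have := lt_of_le_of_ne h1 h2
      have := hle j p
      linarith
    · have := hpW j hj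
      linarith
  have hcombW : ∀ s w, w ∈ W → comb s z₀ w ∈ W := by
    intro s w hw j hj
    rw [hcomb]
    have h1 := hz₀ j
    have h2 := hw j hj
    have h3 := s.2.1
    have h4 := s.2.2
    by_cases hs : (s : ℝ) = 1
    · rw [hs]; linarith
    · have : 0 < 1 - (s : ℝ) := sub_pos.2 (lt_of_le_of_ne h4 hs)
      nlinarith
  -- The functional `f i` is maximal at `p` but not at `z₀`, so a segment from `z₀` can meet `p`
  -- only at its far end. Hence `W` stays star-shaped about `z₀` after `p` is removed.
  have hcombp : ∀ s w, comb s z₀ w = p → w = p := by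
    intro s w h
    have h1 := hz₀ i
    have h2 := hle i w
    have h3 := s.2.1
    have h4 := s.2.2
    have hs : (s : ℝ) = 1 := by
      by_contra hs
      have : 0 < 1 - (s : ℝ) := sub_pos.2 (lt_of_le_of_ne h4 hs)
      have h5 := hcomb s z₀ w i
      rw [h, hside' i] at h5
      nlinarith
    rw [← h]
    apply Subtype.ext
    simp [comb, hs]
  -- the chart around the midpoint
  let g : W → ℂ := fun z => φ (L.chart t z) - φ (L.chart t p)
  have hg : Topology.IsOpenEmbedding g :=
    ((Homeomorph.subRight (φ (L.chart t p))).isOpenEmbedding.comp φ.isOpenEmbedding).comp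
      (isOpenEmbedding_chart hW hWo)
  have hgp : g ⟨p, hpW⟩ = 0 := sub_self _
  obtain ⟨r, hr, hball⟩ := Metric.isOpen_iff.1 hg.isOpen_range 0 ⟨_, hgp⟩
  have hcirc : ∀ τ : ℝ, ∃ w : W, g w = (r / 2 : ℝ) * Complex.exp (τ * Complex.I) := by
    intro τ
    apply hball
    rw [mem_ball_zero_iff, norm_mul, Complex.norm_exp_ofReal_mul_I, Complex.norm_real,
      Real.norm_of_nonneg (by positivity)]
    linarith
  choose γ hγ using hcirc
  have hγc : Continuous γ := by
    rw [hg.isInducing.continuous_iff]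
    have : g ∘ γ = fun τ : ℝ => ((r / 2 : ℝ) : ℂ) * Complex.exp (τ * Complex.I) := funext hγ
    rw [this]
    fun_prop
  -- A small circle around the image of `p` is pulled back to `W` and contracted to `z₀` along
  -- segments that avoid `p`.
  let H : C(unitInterval × ℝ, ℂ) := ⟨fun x => g ⟨comb x.1 z₀ (γ x.2), hcombW _ _ (γ x.2).2⟩,
    hg.continuous.comp (Continuous.subtype_mk (Continuous.subtype_mk (by fun_prop) _) _)⟩
  refine Complex.not_nullhomotopic_circle H ?_ (c := g ⟨z₀, fun j _ => hz₀ j⟩)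
    (r := (r / 2 : ℝ)) ?_ ?_ ?_
  · intro x hx
    have h1 := hcombp _ _ (congrArg Subtype.val (hg.injective (hx.trans hgp.symm)))
    have h2 := hγ x.2
    rw [show γ x.2 = ⟨p, hpW⟩ from Subtype.ext h1, hgp] at h2
    have : ((r / 2 : ℝ) : ℂ) ≠ 0 := by
      exact_mod_cast (half_pos hr).ne'
    exact mul_ne_zero this (Complex.exp_ne_zero _) h2.symm
  · intro τ
    simp only [H, ContinuousMap.coe_mk]
    congr 1
    apply Subtype.ext
    apply Subtype.ext
    simp [comb]
  · intro s
    have : γ (2 * Real.pi) = γ 0 := by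
      apply hg.injective
      rw [hγ, hγ]
      push_cast
      rw [Complex.exp_two_pi_mul_I]
      simp
    simp only [H, ContinuousMap.coe_mk, this]
  · intro τ
    rw [← hγ τ]
    simp only [H, ContinuousMap.coe_mk]
    congr 1
    apply Subtype.ext
    apply Subtype.ext
    simp [comb]

end PentComplex

namespace PentComplex

/-! ### Cell-preserving embeddings -/

/-- An injective map of complexes which carries the boundary of each tile to the boundary of its
image, up to a rotation or a reflection. -/
structure CellEmb (C : PentComplex.{u}) (D : PentComplex.{v}) where
  onVert : C.Vert → D.Vert
  onEdge : C.Edge → D.Edge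
  onTile : C.Tile → D.Tile
  inj_vert : Function.Injective onVert
  inj_edge : Function.Injective onEdge
  inj_tile : Function.Injective onTile
  map_ends : ∀ e, D.ends (onEdge e) = (C.ends e).map onVert
  map_tile : ∀ t, ∃ a : Fin 5,
    (∀ i, onVert (C.vert t i) = D.vert (onTile t) (a + i) ∧
      onEdge (C.edge t i) = D.edge (onTile t) (a + i)) ∨
    (∀ i, onVert (C.vert t i) = D.vert (onTile t) (a - i) ∧
      onEdge (C.edge t i) = D.edge (onTile t) (a - i - 1))

namespace CellEmb

variable {C : PentComplex.{u}} {D : PentComplex.{v}} {E : PentComplex.{w}}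

theorem exists_perm (f : CellEmb C D) (t : C.Tile) : ∃ σ τ : Fin 5 ≃ Fin 5, ∀ i,
    f.onVert (C.vert t i) = D.vert (f.onTile t) (σ i) ∧
      f.onEdge (C.edge t i) = D.edge (f.onTile t) (τ i) := by
  obtain ⟨a, h | h⟩ := f.map_tile t
  · exact ⟨Equiv.addLeft a, Equiv.addLeft a, h⟩
  · exact ⟨Equiv.subLeft a, (Equiv.subLeft a).trans (Equiv.subRight 1), h⟩

theorem exists_onVert_vert (f : CellEmb C D) (t : C.Tile) (i : Fin 5) :
    ∃ j, D.vert (f.onTile t) j = f.onVert (C.vert t i) := by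
  obtain ⟨σ, τ, h⟩ := f.exists_perm t
  exact ⟨σ i, (h i).1.symm⟩

theorem exists_onEdge_edge (f : CellEmb C D) (t : C.Tile) (i : Fin 5) :
    ∃ j, D.edge (f.onTile t) j = f.onEdge (C.edge t i) := by
  obtain ⟨σ, τ, h⟩ := f.exists_perm t
  exact ⟨τ i, (h i).2.symm⟩

theorem exists_vert_onTile (f : CellEmb C D) (t : C.Tile) (j : Fin 5) :
    ∃ i, f.onVert (C.vert t i) = D.vert (f.onTile t) j := by
  obtain ⟨σ, τ, h⟩ := f.exists_perm t
  exact ⟨σ.symm j, by rw [(h _).1, σ.apply_symm_apply]⟩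

theorem exists_edge_onTile (f : CellEmb C D) (t : C.Tile) (j : Fin 5) :
    ∃ i, f.onEdge (C.edge t i) = D.edge (f.onTile t) j := by
  obtain ⟨σ, τ, h⟩ := f.exists_perm t
  exact ⟨τ.symm j, by rw [(h _).2, τ.apply_symm_apply]⟩

def comp (g : CellEmb D E) (f : CellEmb C D) : CellEmb C E where
  onVert := g.onVert ∘ f.onVert
  onEdge := g.onEdge ∘ f.onEdge
  onTile := g.onTile ∘ f.onTile
  inj_vert := g.inj_vert.comp f.inj_vert
  inj_edge := g.inj_edge.comp f.inj_edge
  inj_tile := g.inj_tile.comp f.inj_tile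
  map_ends e := by simp only [Function.comp_apply, g.map_ends, f.map_ends, Sym2.map_map]
  map_tile t := by
    obtain ⟨a, hf | hf⟩ := f.map_tile t <;> obtain ⟨b, hg | hg⟩ := g.map_tile (f.onTile t)
    · refine ⟨b + a, .inl fun i => ?_⟩
      simp only [Function.comp_apply, (hf i).1, (hf i).2, (hg _).1, (hg _).2, add_assoc, and_self]
    · refine ⟨b - a, .inr fun i => ?_⟩
      simp only [Function.comp_apply, (hf i).1, (hf i).2, (hg _).1, (hg _).2, sub_sub, and_self]
    · refine ⟨b + a, .inr fun i => ?_⟩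
      simp only [Function.comp_apply, (hf i).1, (hf i).2, (hg _).1, (hg _).2, add_sub_assoc,
        and_self]
    · refine ⟨b - a, .inl fun i => ?_⟩
      have h1 : b - (a - i) = b - a + i := by abel
      have h2 : b - (a - i - 1) - 1 = b - a + i := by abel
      simp only [Function.comp_apply, (hf i).1, (hf i).2, (hg _).1, (hg _).2, h1, h2, and_self]

/-- The inclusion of a subcomplex. -/
def incl (D : PentComplex.{v}) (S : Set D.Tile) : CellEmb (D.sub S) D where
  onVert := Subtype.val
  onEdge := Subtype.val
  onTile := Subtype.val
  inj_vert := Subtype.val_injective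
  inj_edge := Subtype.val_injective
  inj_tile := Subtype.val_injective
  map_ends _ := (Sym2.attachWith_map_subtypeVal _).symm
  map_tile _ := ⟨0, .inl fun i => by rw [zero_add]; exact ⟨rfl, rfl⟩⟩

/-- An embedding whose tiles lie in `S` factors through the subcomplex spanned by `S`. -/
def lift (f : CellEmb C D) (S : Set D.Tile) (hS : ∀ t, f.onTile t ∈ S) :
    CellEmb C (D.sub S) where
  onVert x := ⟨f.onVert x, by
    obtain ⟨t, i, rfl⟩ := C.vert_surj x
    exact ⟨_, hS t, f.exists_onVert_vert t i⟩⟩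
  onEdge e := ⟨f.onEdge e, by
    obtain ⟨t, i, rfl⟩ := C.edge_surj e
    exact ⟨_, hS t, f.exists_onEdge_edge t i⟩⟩
  onTile t := ⟨f.onTile t, hS t⟩
  inj_vert _ _ h := f.inj_vert (congrArg Subtype.val h)
  inj_edge _ _ h := f.inj_edge (congrArg Subtype.val h)
  inj_tile _ _ h := f.inj_tile (congrArg Subtype.val h)
  map_ends e := by
    apply Sym2.map.injective Subtype.val_injective
    refine ((Sym2.attachWith_map_subtypeVal _).trans (f.map_ends e)).trans ?_
    generalize C.ends e = z
    induction z with | _ x y => rfl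
  map_tile t := by
    obtain ⟨a, h | h⟩ := f.map_tile t
    · exact ⟨a, .inl fun i => ⟨Subtype.ext (h i).1, Subtype.ext (h i).2⟩⟩
    · exact ⟨a, .inr fun i => ⟨Subtype.ext (h i).1, Subtype.ext (h i).2⟩⟩

/-- An embedding is an isomorphism onto the subcomplex spanned by its tiles. -/
noncomputable def isoRange (f : CellEmb C D) : Iso C (D.sub (Set.range f.onTile)) :=
  let g := f.lift (Set.range f.onTile) Set.mem_range_self
  { onVert := Equiv.ofBijective g.onVert ⟨g.inj_vert, by
      rintro ⟨x, _, ⟨t, rfl⟩, j, rfl⟩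
      obtain ⟨i, hi⟩ := f.exists_vert_onTile t j
      exact ⟨_, Subtype.ext hi⟩⟩
    onEdge := Equiv.ofBijective g.onEdge ⟨g.inj_edge, by
      rintro ⟨x, _, ⟨t, rfl⟩, j, rfl⟩
      obtain ⟨i, hi⟩ := f.exists_edge_onTile t j
      exact ⟨_, Subtype.ext hi⟩⟩
    onTile := Equiv.ofBijective g.onTile ⟨g.inj_tile, by
      rintro ⟨_, t, rfl⟩
      exact ⟨t, rfl⟩⟩
    map_ends := g.map_ends
    map_tile := g.map_tile }

end CellEmb

section

variable {C : PentComplex.{u}} {D : PentComplex.{v}} {E : PentComplex.{w}}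

def Iso.toCellEmb (f : Iso C D) : CellEmb C D where
  onVert := f.onVert
  onEdge := f.onEdge
  onTile := f.onTile
  inj_vert := f.onVert.injective
  inj_edge := f.onEdge.injective
  inj_tile := f.onTile.injective
  map_ends := f.map_ends
  map_tile := f.map_tile

def Iso.symm (f : Iso C D) : Iso D C where
  onVert := f.onVert.symm
  onEdge := f.onEdge.symm
  onTile := f.onTile.symm
  map_ends e := by
    obtain ⟨e, rfl⟩ := f.onEdge.surjective e
    rw [f.map_ends, Sym2.map_map]
    simp
  map_tile t := by
    obtain ⟨t, rfl⟩ := f.onTile.surjective t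
    obtain ⟨a, h | h⟩ := f.map_tile t
    · refine ⟨-a, .inl fun i => ?_⟩
      have h' := h (-a + i)
      rw [add_neg_cancel_left] at h'
      rw [f.onTile.symm_apply_apply, ← h'.1, ← h'.2]
      simp
    · refine ⟨a, .inr fun i => ?_⟩
      have h1 := (h (a - i)).1
      have h2 := (h (a - i - 1)).2
      rw [show a - (a - i) = i by abel] at h1
      rw [show a - (a - i - 1) - 1 = i by abel] at h2
      rw [f.onTile.symm_apply_apply, ← h1, ← h2]
      simp

def Emb.toCellEmb (f : Emb C D) : CellEmb C D where
  onVert := f.onVert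
  onEdge := f.onEdge
  onTile := f.onTile
  inj_vert := f.inj_vert
  inj_edge := f.inj_edge
  inj_tile := f.inj_tile
  map_ends := f.map_ends
  map_tile t := ⟨0, .inl fun i => by rw [zero_add]; exact ⟨f.map_vert t i, f.map_edge t i⟩⟩

def Emb.comp (g : Emb D E) (f : Emb C D) : Emb C E where
  onVert := g.onVert ∘ f.onVert
  onEdge := g.onEdge ∘ f.onEdge
  onTile := g.onTile ∘ f.onTile
  map_ends e := by simp only [Function.comp_apply, g.map_ends, f.map_ends, Sym2.map_map]
  map_vert t i := by simp only [Function.comp_apply, f.map_vert, g.map_vert]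
  map_edge t i := by simp only [Function.comp_apply, f.map_edge, g.map_edge]
  inj_vert := g.inj_vert.comp f.inj_vert
  inj_edge := g.inj_edge.comp f.inj_edge
  inj_tile := g.inj_tile.comp f.inj_tile

end

/-! ### Embedded tiles and edges of degree at most two -/

/-- The tiles of the complex are embedded pentagons and each edge lies on at most two tiles. -/
structure IsTame (C : PentComplex.{u}) : Prop where
  vert_inj : ∀ t, Function.Injective (C.vert t)
  edge_inj : ∀ t, Function.Injective (C.edge t)
  edge_deg : ∀ t₁ t₂ t₃ i₁ i₂ i₃, C.edge t₁ i₁ = C.edge t₂ i₂ → C.edge t₁ i₁ = C.edge t₃ i₃ →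
    t₁ = t₂ ∨ t₁ = t₃ ∨ t₂ = t₃

theorem IsTame.of_cellEmb {C : PentComplex.{u}} {D : PentComplex.{v}} (hD : D.IsTame)
    (f : CellEmb C D) : C.IsTame where
  vert_inj t i j h := by
    obtain ⟨σ, τ, hσ⟩ := f.exists_perm t
    apply σ.injective
    apply hD.vert_inj (f.onTile t)
    rw [← (hσ i).1, ← (hσ j).1, h]
  edge_inj t i j h := by
    obtain ⟨σ, τ, hσ⟩ := f.exists_perm t
    apply τ.injective
    apply hD.edge_inj (f.onTile t)
    rw [← (hσ i).2, ← (hσ j).2, h]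
  edge_deg t₁ t₂ t₃ i₁ i₂ i₃ h h' := by
    obtain ⟨j₁, h₁⟩ := f.exists_onEdge_edge t₁ i₁
    obtain ⟨j₂, h₂⟩ := f.exists_onEdge_edge t₂ i₂
    obtain ⟨j₃, h₃⟩ := f.exists_onEdge_edge t₃ i₃
    simp only [← f.inj_tile.eq_iff]
    exact hD.edge_deg _ _ _ j₁ j₂ j₃ (by rw [h₁, h₂, h]) (by rw [h₁, h₃, h'])

/-- Each condition involves at most three tiles at a time. -/
theorem IsTame.of_finite {L : PentComplex.{u}}
    (h : ∀ S : Set L.Tile, S.Finite → (L.sub S).IsTame) : L.IsTame where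
  vert_inj t i j hij :=
    (h {t} (Set.finite_singleton t)).vert_inj ⟨t, rfl⟩ (Subtype.ext hij)
  edge_inj t i j hij :=
    (h {t} (Set.finite_singleton t)).edge_inj ⟨t, rfl⟩ (Subtype.ext hij)
  edge_deg t₁ t₂ t₃ i₁ i₂ i₃ h₂ h₃ := by
    have := (h {t₁, t₂, t₃} (Set.toFinite _)).edge_deg ⟨t₁, by simp⟩ ⟨t₂, by simp⟩ ⟨t₃, by simp⟩
      i₁ i₂ i₃ (Subtype.ext h₂) (Subtype.ext h₃)
    exact this.imp (congrArg Subtype.val) (Or.imp (congrArg Subtype.val) (congrArg Subtype.val))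

theorem IsTame.of_locallyIsomorphic {L : PentComplex.{u}} {K : PentComplex.{v}} (hK : K.IsTame)
    (h : L.LocallyIsomorphic K) : L.IsTame := by
  refine .of_finite fun S hS => ?_
  obtain ⟨Q, -, ⟨f⟩⟩ := h S hS
  exact hK.of_cellEmb ((CellEmb.incl K Q).comp f.toCellEmb)

theorem isTame_pentagon : pentagon.IsTame where
  vert_inj _ _ _ h := h
  edge_inj _ _ _ h := h
  edge_deg _ _ _ _ _ _ _ _ := .inl rfl

section omega

variable {C : PentComplex.{u}}

theorem edge_corner_eq_half {t : C.Tile} {k i : Fin 5} {x : C.Vert} {e : C.Edge}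
    {hx : x ∈ C.ends e} (h : C.omega.edge (.corner t k) i = SubEdge.half x e hx) :
    C.vert t k = x ∧ ∃ j, C.edge t j = e := by
  fin_cases i <;> simp [omega] at h
  · exact ⟨h.1, _, h.2⟩
  · exact ⟨h.1, _, h.2⟩

theorem edge_corner_eq_spoke {t s : C.Tile} {k i j : Fin 5}
    (h : C.omega.edge (.corner t k) i = SubEdge.spoke s j) :
    t = s ∧ (k = j ∨ k = j + 1) := by
  fin_cases i <;> simp [omega] at h
  · exact ⟨h.1, .inl h.2⟩
  · exact ⟨h.1, .inr (by rw [← h.2]; abel)⟩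

theorem edge_corner_eq_inner {t s : C.Tile} {k i j : Fin 5}
    (h : C.omega.edge (.corner t k) i = SubEdge.inner s j) :
    t = s ∧ k = j + 1 := by
  fin_cases i <;> simp [omega] at h
  exact ⟨h.1, by rw [← h.2]; abel⟩

/-- A half edge inherits its degree from the old edge, its old end point singling out one corner of
each parent tile. A spoke lies only on the two corner tiles beside it, an inner side only on the
centre and one corner tile. -/
theorem IsTame.omega (hC : C.IsTame) : C.omega.IsTame where
  vert_inj t := by
    cases t with
    | center t => exact fun i j h => (SubVert.inner.inj h).2
    | corner t k =>
      have hk : k ≠ k - 1 := by clear * -; revert k; decide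
      have h1 : C.edge t k ≠ C.edge t (k - 1) := fun h => hk (hC.edge_inj t h)
      intro i j h
      fin_cases i <;> fin_cases j <;> simp [PentComplex.omega, h1, h1.symm, hk, hk.symm] at h ⊢
  edge_inj t := by
    cases t with
    | center t => exact fun i j h => (SubEdge.inner.inj h).2
    | corner t k =>
      have hk : k ≠ k - 1 := by clear * -; revert k; decide
      have h1 : C.edge t k ≠ C.edge t (k - 1) := fun h => hk (hC.edge_inj t h)
      intro i j h
      fin_cases i <;> fin_cases j <;> simp [PentComplex.omega, h1, h1.symm, hk, hk.symm] at h ⊢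
  edge_deg := by
    intro t₁ t₂ t₃ i₁ i₂ i₃ h₂ h₃
    generalize he : C.omega.edge t₁ i₁ = e at h₂ h₃
    cases e with
    | half x e hx =>
      cases t₁ with
      | center t => cases he
      | corner t₁ k₁ =>
      cases t₂ with
      | center t => cases h₂
      | corner t₂ k₂ =>
      cases t₃ with
      | center t => cases h₃
      | corner t₃ k₃ =>
      obtain ⟨hx₁, j₁, he₁⟩ := edge_corner_eq_half he
      obtain ⟨hx₂, j₂, he₂⟩ := edge_corner_eq_half h₂.symm
      obtain ⟨hx₃, j₃, he₃⟩ := edge_corner_eq_half h₃.symm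
      rcases hC.edge_deg t₁ t₂ t₃ j₁ j₂ j₃ (he₁.trans he₂.symm) (he₁.trans he₃.symm) with
        rfl | rfl | rfl
      · exact .inl (congrArg _ (hC.vert_inj _ (hx₁.trans hx₂.symm)))
      · exact .inr (.inl (congrArg _ (hC.vert_inj _ (hx₁.trans hx₃.symm))))
      · exact .inr (.inr (congrArg _ (hC.vert_inj _ (hx₂.trans hx₃.symm))))
    | spoke t i =>
      cases t₁ with
      | center t => cases he
      | corner t₁ k₁ =>
      cases t₂ with
      | center t => cases h₂
      | corner t₂ k₂ =>
      cases t₃ with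
      | center t => cases h₃
      | corner t₃ k₃ =>
      obtain ⟨rfl, hk₁⟩ := edge_corner_eq_spoke he
      obtain ⟨rfl, hk₂⟩ := edge_corner_eq_spoke h₂.symm
      obtain ⟨rfl, hk₃⟩ := edge_corner_eq_spoke h₃.symm
      rcases hk₁ with rfl | rfl <;> rcases hk₂ with rfl | rfl <;> rcases hk₃ with rfl | rfl <;>
        first | exact .inl rfl | exact .inr (.inl rfl) | exact .inr (.inr rfl)
    | inner t i =>
      have key : ∀ s j, C.omega.edge s j = SubEdge.inner t i →
          s = .center t ∨ s = .corner t (i + 1) := by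
        intro s j h
        cases s with
        | center s => exact .inl (congrArg _ (SubEdge.inner.inj h).1)
        | corner s k =>
          obtain ⟨rfl, rfl⟩ := edge_corner_eq_inner h
          exact .inr rfl
      rcases key _ _ he with rfl | rfl <;> rcases key _ _ h₂.symm with rfl | rfl <;>
        rcases key _ _ h₃.symm with rfl | rfl <;>
        first | exact .inl rfl | exact .inr (.inl rfl) | exact .inr (.inr rfl)

end omega

theorem isTame_supertile : ∀ n, (supertile n).IsTame
  | 0 => isTame_pentagon
  | n + 1 => (isTame_supertile n).omega

/-! ### The supertiles inside the tiling -/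

/-- The canonical embedding of the supertile `K_n` into `K`. -/
def toTilingK (n : ℕ) : Emb (supertile n) tilingK where
  onVert := Lim.of (fun n => (iota n).onVert) n
  onEdge := Lim.of (fun n => (iota n).onEdge) n
  onTile := Lim.of (fun n => (iota n).onTile) n
  map_ends _ := rfl
  map_vert _ _ := rfl
  map_edge _ _ := rfl
  inj_vert := Lim.of_injective _ (fun n => (iota n).inj_vert) n
  inj_edge := Lim.of_injective _ (fun n => (iota n).inj_edge) n
  inj_tile := Lim.of_injective _ (fun n => (iota n).inj_tile) n

theorem monotone_range_toTilingK : Monotone fun n => Set.range (toTilingK n).onTile := by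
  refine monotone_nat_of_le_succ fun n => ?_
  rintro _ ⟨t, rfl⟩
  exact ⟨(iota n).onTile t, Lim.of_succ (fun n => (iota n).onTile) n t⟩

theorem exists_subset_range_toTilingK {S : Set tilingK.Tile} (hS : S.Finite) :
    ∃ n, S ⊆ Set.range (toTilingK n).onTile := by
  induction S, hS using Set.Finite.induction_on with
  | empty => exact ⟨0, Set.empty_subset _⟩
  | @insert T S _ _ ih =>
    obtain ⟨n, hn⟩ := ih
    obtain ⟨⟨m, t⟩, rfl⟩ := Quotient.exists_rep T
    refine ⟨max m n, Set.insert_subset ?_ (hn.trans (monotone_range_toTilingK (le_max_right m n)))⟩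
    exact monotone_range_toTilingK (le_max_left m n) ⟨t, rfl⟩

theorem isTame_tilingK : tilingK.IsTame := by
  refine .of_finite fun S hS => ?_
  obtain ⟨n, hn⟩ := exists_subset_range_toTilingK hS
  exact (isTame_supertile n).of_cellEmb ((toTilingK n).toCellEmb.isoRange.symm.toCellEmb.comp
    ((CellEmb.incl tilingK S).lift _ fun t => hn t.2))

/-- The embedding of the combinatorial pentagon onto a tile. -/
def IsTame.tileEmb {C : PentComplex.{u}} (hC : C.IsTame) (t : C.Tile) : Emb pentagon C where
  onVert := C.vert t
  onEdge := C.edge t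
  onTile _ := t
  map_ends i := C.ends_edge t i
  map_vert _ _ := rfl
  map_edge _ _ := rfl
  inj_vert := hC.vert_inj t
  inj_edge := hC.edge_inj t
  inj_tile _ _ _ := rfl

/-- The embedding `K_n → K_{m+n}` whose image is the `n`-fold subdivision of a tile of `K_m`. -/
def supertileEmb (m : ℕ) (t : (supertile m).Tile) : ∀ n, Emb (supertile n) (supertile (m + n))
  | 0 => (isTame_supertile m).tileEmb t
  | n + 1 => (supertileEmb m t n).omega

theorem exists_mem_range_supertileEmb (m n : ℕ) (T : (supertile (m + n)).Tile) :
    ∃ t s, (supertileEmb m t n).onTile s = T := by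
  induction n with
  | zero => exact ⟨T, (), rfl⟩
  | succ n ih =>
    cases T with
    | center T =>
      obtain ⟨t, s, rfl⟩ := ih T
      exact ⟨t, .center s, rfl⟩
    | corner T k =>
      obtain ⟨t, s, rfl⟩ := ih T
      exact ⟨t, .corner s k, rfl⟩

theorem exists_emb_supertile_tilingK (n : ℕ) (T : tilingK.Tile) :
    ∃ (f : Emb (supertile n) tilingK) (s : (supertile n).Tile), f.onTile s = T := by
  obtain ⟨m, hm⟩ := exists_subset_range_toTilingK (Set.finite_singleton T)
  -- Going `n` stages further puts the tile inside the `n`-fold subdivision of some tile of `K_m`.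
  obtain ⟨T', rfl⟩ := monotone_range_toTilingK (Nat.le_add_right m n) (hm rfl)
  obtain ⟨t, s, rfl⟩ := exists_mem_range_supertileEmb m n T'
  exact ⟨(toTilingK (m + n)).comp (supertileEmb m t n), s, rfl⟩

/-! ### Balls -/

/-- Two tiles are adjacent if they share an edge. -/
def Adj (C : PentComplex.{u}) (s t : C.Tile) : Prop := ∃ i j, C.edge s i = C.edge t j

/-- The tiles which can be reached from `t` by crossing at most `n` edges. -/
def ball (C : PentComplex.{u}) (t : C.Tile) : ℕ → Set C.Tile
  | 0 => {t}
  | n + 1 => {u | ∃ s ∈ C.ball t n, C.Adj s u}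

/-- Adjacency is reflexive: a tile shares its side 0 with itself. -/
theorem monotone_ball (C : PentComplex.{u}) (t : C.Tile) : Monotone (C.ball t) :=
  monotone_nat_of_le_succ fun _ s hs => ⟨s, hs, 0, 0, rfl⟩

theorem mem_ball_self (C : PentComplex.{u}) (t : C.Tile) (n : ℕ) : t ∈ C.ball t n :=
  C.monotone_ball t (Nat.zero_le n) rfl

theorem Emb.onTile_mem_ball {C : PentComplex.{u}} {D : PentComplex.{v}} (f : Emb C D)
    {t : C.Tile} : ∀ {n : ℕ} {s : C.Tile}, s ∈ C.ball t n → f.onTile s ∈ D.ball (f.onTile t) n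
  | 0, _, h => congrArg f.onTile h
  | _ + 1, _, ⟨u, hu, i, j, h⟩ => ⟨f.onTile u, f.onTile_mem_ball hu, i, j, by
      rw [← f.map_edge, ← f.map_edge, h]⟩

theorem IsTame.finite_ball {C : PentComplex.{u}} (hC : C.IsTame) (t : C.Tile) (n : ℕ) :
    (C.ball t n).Finite := by
  induction n with
  | zero => exact Set.finite_singleton t
  | succ n ih =>
    have hA : ∀ s i, {u | ∃ j, C.edge s i = C.edge u j}.Finite := by
      intro s i
      by_cases h : ∃ v j, v ≠ s ∧ C.edge s i = C.edge v j
      · obtain ⟨v, j, hv, hj⟩ := h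
        refine (Set.toFinite {s, v}).subset ?_
        rintro u ⟨k, hk⟩
        rcases hC.edge_deg s v u i j k hj hk with h | h | h
        · exact absurd h.symm hv
        · exact .inl h.symm
        · exact .inr h.symm
      · refine (Set.finite_singleton s).subset ?_
        rintro u ⟨k, hk⟩
        by_contra hu
        exact h ⟨u, k, hu, hk⟩
    refine (ih.biUnion fun s _ => Set.finite_iUnion (hA s)).subset ?_
    rintro u ⟨s, hs, i, j, h⟩
    exact Set.mem_biUnion hs (Set.mem_iUnion.2 ⟨i, j, h⟩)

theorem exists_mem_ball {C : PentComplex.{u}} {s t : C.Tile}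
    (h : Relation.ReflTransGen C.Adj s t) : ∃ n, t ∈ C.ball s n := by
  induction h with
  | refl => exact ⟨0, rfl⟩
  | tail _ h ih =>
    obtain ⟨n, hn⟩ := ih
    exact ⟨n + 1, _, hn, h⟩

theorem Adj.symm {C : PentComplex.{u}} {s t : C.Tile} : C.Adj s t → C.Adj t s
  | ⟨i, j, h⟩ => ⟨j, i, h.symm⟩

theorem adj_center_corner {C : PentComplex.{u}} (t : C.Tile) (k : Fin 5) :
    C.omega.Adj (.center t) (.corner t k) :=
  ⟨k - 1, 2, rfl⟩

/-- At a common end of the shared edge, the corner tiles of `s` and `t` share a half edge; the path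
runs centre, corner, corner, centre. -/
theorem Adj.reflTransGen_center {C : PentComplex.{u}} {s t : C.Tile} (h : C.Adj s t) :
    Relation.ReflTransGen C.omega.Adj (.center s) (.center t) := by
  obtain ⟨i, j, h⟩ := h
  have key : ∃ k, C.omega.Adj (.corner s i) (.corner t k) := by
    have hx := C.mem_ends_left s i
    rw [h, C.ends_edge, Sym2.mem_iff] at hx
    rcases hx with hx | hx
    · refine ⟨j, 0, 0, ?_⟩
      simp [PentComplex.omega, h, hx]
    · refine ⟨j + 1, 0, 4, ?_⟩
      have : j + 1 - 1 = j := by abel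
      simp [PentComplex.omega, h, hx, this]
  obtain ⟨k, hk⟩ := key
  exact ((Relation.ReflTransGen.single (adj_center_corner s i)).tail hk).tail
    (adj_center_corner t k).symm

theorem supertile_connected (n : ℕ) (s t : (supertile n).Tile) :
    Relation.ReflTransGen (supertile n).Adj s t := by
  induction n with
  | zero => exact .refl
  | succ n ih =>
    have hc : ∀ s t, Relation.ReflTransGen (supertile n).omega.Adj (.center s) (.center t) :=
      fun s t => Relation.ReflTransGen.lift' SubTile.center
        (fun _ _ h => h.reflTransGen_center) _ _ (ih s t)
    cases s with
    | center s =>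
      cases t with
      | center t => exact hc s t
      | corner t k => exact (hc s t).tail (adj_center_corner t k)
    | corner s i =>
      refine .head (adj_center_corner s i).symm ?_
      cases t with
      | center t => exact hc s t
      | corner t k => exact (hc s t).tail (adj_center_corner t k)

instance finite_tile_supertile (n : ℕ) : Finite (supertile n).Tile := by
  induction n with
  | zero => exact inferInstanceAs (Finite Unit)
  | succ n ih =>
    refine Finite.of_surjective (α := (supertile n).Tile ⊕ (supertile n).Tile × Fin 5)
      (Sum.elim SubTile.center fun x => SubTile.corner x.1 x.2) ?_
    rintro (t | ⟨t, k⟩)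
    · exact ⟨.inl t, rfl⟩
    · exact ⟨.inr (t, k), rfl⟩

theorem exists_radius_supertile (n : ℕ) :
    ∃ R, ∀ s t : (supertile n).Tile, t ∈ (supertile n).ball s R := by
  choose r hr using fun x : (supertile n).Tile × (supertile n).Tile =>
    exists_mem_ball (supertile_connected n x.1 x.2)
  obtain ⟨R, hR⟩ := Finite.exists_le r
  exact ⟨R, fun s t => monotone_ball _ s (hR (s, t)) (hr (s, t))⟩

/-! ### Supertiles in locally isomorphic tilings -/

/-- If every edge of `L` lies on two tiles, then an isomorphism from a ball of `L` to a patch of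
`K` covers the ball of the same radius in `K`. -/
theorem ball_subset_of_iso {L : PentComplex.{u}} {K : PentComplex.{v}} (hL : L.IsTame)
    (hK : K.IsTame)
    (hside : ∀ t i, ∃ t' j, L.edge t' j = L.edge t i ∧ ¬ (t' = t ∧ j = i))
    {t₀ : L.Tile} {R : ℕ} {Q : Set K.Tile} (φ : Iso (L.sub (L.ball t₀ R)) (K.sub Q)) (r : ℕ)
    (hr : r ≤ R) (T : K.Tile)
    (hT : T ∈ K.ball (φ.onTile ⟨t₀, L.mem_ball_self t₀ R⟩).1 r) :
    ∃ v, ∃ hv : v ∈ L.ball t₀ R, v ∈ L.ball t₀ r ∧ (φ.onTile ⟨v, hv⟩).1 = T := by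
  induction r generalizing T with
  | zero => exact ⟨t₀, L.mem_ball_self t₀ R, rfl, hT.symm⟩
  | succ r ih =>
    obtain ⟨U, hU, i, j, hij⟩ := hT
    obtain ⟨u, hu, hur, rfl⟩ := ih (Nat.le_of_succ_le hr) U hU
    obtain ⟨i', hi'⟩ := φ.toCellEmb.exists_edge_onTile ⟨u, hu⟩ i
    obtain ⟨v, j', hj', hne⟩ := hside u i'
    -- The other side on this edge cannot belong to `u` itself, since the sides of a tile are
    -- distinct edges.
    have hvu : v ≠ u := by
      rintro rfl
      exact hne ⟨rfl, hL.edge_inj v hj'⟩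
    have hvr : v ∈ L.ball t₀ (r + 1) := ⟨u, hur, i', j', hj'.symm⟩
    have hv : v ∈ L.ball t₀ R := L.monotone_ball t₀ hr hvr
    obtain ⟨k, hk⟩ := φ.toCellEmb.exists_onEdge_edge ⟨v, hv⟩ j'
    have hedge : (L.sub (L.ball t₀ R)).edge ⟨v, hv⟩ j' = (L.sub (L.ball t₀ R)).edge ⟨u, hu⟩ i' :=
      Subtype.ext hj'
    rw [hedge, hi'] at hk
    -- The images of `u` and `v` are distinct tiles on this edge of `K`, so the third tile `T` is
    -- one of them.
    rcases hK.edge_deg _ _ _ i j k hij (congrArg Subtype.val hk).symm with h | h | h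
    · exact ⟨u, hu, L.monotone_ball t₀ (Nat.le_succ r) hur, h⟩
    · exact absurd (congrArg Subtype.val (φ.onTile.injective (Subtype.ext h))).symm hvu
    · exact ⟨v, hv, hvr, h.symm⟩

theorem nonempty_cellEmb_supertile {L : PentComplex.{u}} (hL : L.IsCombinatorialTiling)
    (hloc : L.LocallyIsomorphic tilingK) (n : ℕ) : Nonempty (CellEmb (supertile n) L) := by
  have hLt := isTame_tilingK.of_locallyIsomorphic hloc
  obtain ⟨t₀⟩ : Nonempty L.Tile := by
    obtain ⟨φ⟩ := hL
    obtain ⟨x, -⟩ := Quot.exists_rep (φ.symm 0)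
    exact ⟨x.1⟩
  obtain ⟨R, hR⟩ := exists_radius_supertile n
  obtain ⟨Q, -, ⟨φ⟩⟩ := hloc _ (hLt.finite_ball t₀ R)
  obtain ⟨f, s, hs⟩ := exists_emb_supertile_tilingK n (φ.onTile ⟨t₀, L.mem_ball_self t₀ R⟩).1
  -- The copy of `K_n` contains the image of `t₀` and `R` bounds its diameter, so it lies in the
  -- `R`-ball of `K`, which `Q` covers.
  have hQ : ∀ t, f.onTile t ∈ Q := by
    intro t
    have ht := f.onTile_mem_ball (hR s t)
    rw [hs] at ht
    obtain ⟨v, hv, -, h⟩ :=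
      ball_subset_of_iso hLt isTame_tilingK hL.exists_other_side φ R le_rfl _ ht
    exact h ▸ (φ.onTile ⟨v, hv⟩).2
  exact ⟨(CellEmb.incl L _).comp (φ.symm.toCellEmb.comp (f.toCellEmb.lift Q hQ))⟩

end PentComplex

theorem mainTheorem6 (ξ : ContinuousHull.{u}) (p : PointedTiling.{u})
    (hp : ContinuousHull.mk p = ξ) :
    (∀ n : ℕ, (PentComplex.supertile n).IsFiniteSubcomplexOf p.L) ∧
      PentComplex.tilingK.LocallyIsomorphic p.L := by
  have key := PentComplex.nonempty_cellEmb_supertile p.tiling p.locIso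
  constructor
  · intro n
    obtain ⟨f⟩ := key n
    exact ⟨_, Set.finite_range f.onTile, ⟨f.isoRange⟩⟩
  · intro S hS
    obtain ⟨n, hn⟩ := PentComplex.exists_subset_range_toTilingK hS
    obtain ⟨f⟩ := key n
    -- The patch is moved from `K` into the supertile containing it, and from there into `L`.
    let g := f.comp ((PentComplex.toTilingK n).toCellEmb.isoRange.symm.toCellEmb.comp
      ((PentComplex.CellEmb.incl PentComplex.tilingK S).lift _ fun t => hn t.2))
    have : Finite (PentComplex.tilingK.sub S).Tile := hS.to_subtype
    exact ⟨_, Set.finite_range g.onTile, ⟨g.isoRange⟩⟩
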